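/- Let $A$ be a commutative unital $\mathbb{R}$-algebra. Let $\mathcal{X}(A)$ be the set of all unital $\mathbb{R}$-algebra homomorphisms $\alpha : A \to \mathbb{R}$, with the topology induced from the product topology on $\mathbb{R}^A$, and for $a \in A$ let $\hat{a} : \mathcal{X}(A) \to \mathbb{R}$, $\hat{a}(\alpha) = \alpha(a)$. Let $\rho : A \to [0,\infty)$ be a submultiplicative seminorm, i.e. $\rho(ra) = |r|\rho(a)$, $\rho(a+b) \le \rho(a)+\rho(b)$ and $\rho(ab) \le \rho(a)\rho(b)$ for all $r \in \mathbb{R}$, $a,b \in A$. Let $d \ge 1$ be an integer and let $S \subseteq A$ be a $\sum A^{2d}$-module, i.e. $1 \in S$, $S + S \subseteq S$ and $a^{2d} S \subseteq S$ for every $a \in A$. Put $$\mathcal{K}_S = \{\alpha \in \mathcal{X}(A) : \alpha(s) \ge 0 \text{ for all } s \in S\}, \qquad \mathfrak{sp}_\rho(A) = \{\alpha \in \mathcal{X}(A) : \alpha \text{ is } \rho\text{-continuous}\}.$$ A Radon measure on $\mathcal{X}(A)$ is a (nonnegative) measure $\mu$ on the Borel $\sigma$-algebra that is locally finite (every point has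 a neighbourhood of finite measure) and inner regular ($\mu(E) = \sup\{\mu(K) : K \subseteq E \text{ compact}\}$ for every Borel set $E$); its support $\operatorname{supp}(\mu)$ is the set of points all of whose neighbourhoods have positive measure. If $L : A \to \mathbb{R}$ is a $\rho$-continuous linear functional such that $L(s) \ge 0$ for all $s \in S$, then there exists a unique Radon measure $\mu$ on $\mathcal{X}(A)$ such that, for all $a \in A$, $\hat{a}$ is $\mu$-integrable and $$L(a) = \int \hat{a}\, d\mu .$$ Moreover, $\operatorname{supp}(\mu) \subseteq \mathcal{K}_S \cap \mathfrak{sp}_\rho(A)$, and the set $\mathcal{K}_S \cap \mathfrak{sp}_\rho(A)$ is compact. -/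

import Mathlib

open MeasureTheory

namespace RealMoment

/-- The space of unital `ℝ`-algebra homomorphisms `A → ℝ`. -/
abbrev Characters (A : Type*) [CommRing A] [Algebra ℝ A] : Type _ := A →ₐ[ℝ] ℝ

/-- The topology on the characters as a subspace of the product `ℝ^A`. -/
instance instTopologicalSpaceCharacters {A : Type*} [CommRing A] [Algebra ℝ A] :
    TopologicalSpace (Characters A) :=
  TopologicalSpace.induced (fun (α : Characters A) (a : A) => α a) inferInstance

/-- The Borel `σ`-algebra on the characters. -/
instance instMeasurableSpaceCharacters {A : Type*} [CommRing A] [Algebra ℝ A] :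
    MeasurableSpace (Characters A) :=
  borel (Characters A)

instance instBorelSpaceCharacters {A : Type*} [CommRing A] [Algebra ℝ A] :
    BorelSpace (Characters A) :=
  ⟨rfl⟩

/-- The evaluation map `â(α) = α(a)`. -/
def hat {A : Type*} [CommRing A] [Algebra ℝ A] (a : A) (α : Characters A) : ℝ := α a

/-- `S` is a `ΣA^{2d}`-module of `A`: `1 ∈ S`, `S + S ⊆ S` and `a^{2d} S ⊆ S` for all `a ∈ A`. -/
structure IsPowerModule {A : Type*} [CommRing A] [Algebra ℝ A] (d : ℕ) (S : Set A) : Prop where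
  one_mem : (1 : A) ∈ S
  add_mem : ∀ s ∈ S, ∀ t ∈ S, s + t ∈ S
  pow_mul_mem : ∀ a : A, ∀ s ∈ S, a ^ (2 * d) * s ∈ S

/-- The nonnegativity set `K_S` of a subset `S` of `A`. -/
def nonnegSet {A : Type*} [CommRing A] [Algebra ℝ A] (S : Set A) : Set (Characters A) :=
  {α | ∀ a ∈ S, 0 ≤ hat a α}

/-- Submultiplicativity of a seminorm; no condition on `ρ 1`. -/
def IsSubmultiplicative {A : Type*} [CommRing A] [Algebra ℝ A] (ρ : Seminorm ℝ A) : Prop :=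
  ∀ x y : A, ρ (x * y) ≤ ρ x * ρ y

/-- Continuity of `f : A → ℝ` for the topology defined by the pseudometric `ρ (x - y)`. -/
def IsSeminormContinuous {A : Type*} [CommRing A] [Algebra ℝ A] (ρ : Seminorm ℝ A)
    (f : A → ℝ) : Prop :=
  @Continuous A ℝ ρ.toSeminormedAddCommGroup.toUniformSpace.toTopologicalSpace _ f

/-- The Gelfand spectrum of `(A, ρ)`: the `ρ`-continuous characters. -/
def gelfandSpectrum {A : Type*} [CommRing A] [Algebra ℝ A] (ρ : Seminorm ℝ A) :
    Set (Characters A) :=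
  {α | IsSeminormContinuous ρ (fun a => α a)}

/-- A Radon measure: a locally finite Borel measure for which every Borel set is approximated
from within by compact sets. -/
structure IsRadon {X : Type*} [TopologicalSpace X] [MeasurableSpace X] [BorelSpace X]
    (μ : Measure X) : Prop where
  locallyFinite : IsLocallyFiniteMeasure μ
  innerRegular : μ.InnerRegular

/-- `L(a) = ∫ â dμ` for all `a ∈ A`, all these integrals being convergent. -/
def Represents {A : Type*} [CommRing A] [Algebra ℝ A] (μ : Measure (Characters A))
    (L : A →ₗ[ℝ] ℝ) : Prop :=
  ∀ a : A, Integrable (hat a) μ ∧ L a = ∫ α, hat a α ∂μ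

end RealMoment

namespace RealMoment

open Filter Topology

/-! Put `m = 2d`. If `ρ x < 1`, the binomial series gives an `m`-th root of `1 + x` in the
completion of `(A, ρ)`, so `1 + x` is a `ρ`-limit of `m`-th powers from `A`. Hence a `ρ`-continuous
functional `f` that is nonnegative on `m`-th powers is bounded by `f 1 * ρ`, and `w ↦ f ((1 + x) *
w)` is of the same kind.

The normalised functionals form a compact convex set. An extreme point is an average of its
normalised twists by `1 + x` and `1 - x`, which makes it multiplicative. By Krein–Milman, `L` is
nonnegative on every element that is nonnegative on the compact Gelfand spectrum; Riesz extension
and Riesz–Markov then give a measure.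

Conversely, the growth of `L (a ^ (2 * n))` confines every representing Radon measure to the Gelfand
spectrum. There Stone–Weierstrass gives uniqueness, and testing against the negative part of `hat s`
puts the support in `nonnegSet S`. -/

/-! ### Roots of `1 + x` by the binomial series -/

/-- Consecutive coefficients have ratio `(r - k) / (k + 1)`, of absolute value at most 1. -/
theorem abs_choose_le_one {r : ℝ} (h0 : 0 ≤ r) (h1 : r ≤ 1) (k : ℕ) : |Ring.choose r k| ≤ 1 := by
  induction k with
  | zero => simp
  | succ k ih =>
    have h := Ring.choose_smul_choose r (Nat.le_succ k)
    simp only [Nat.succ_eq_add_one, Nat.choose_succ_self_right, nsmul_eq_mul, add_tsub_cancel_left,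
      Ring.choose_one_right] at h
    have hk : |r - k| ≤ k + 1 := by
      rw [abs_le]; constructor <;> linarith [(Nat.cast_nonneg k : (0 : ℝ) ≤ k)]
    have h2 : ((k + 1 : ℕ) : ℝ) * |Ring.choose r (k + 1)| ≤ ((k + 1 : ℕ) : ℝ) * 1 := by
      rw [← abs_of_nonneg (Nat.cast_nonneg (α := ℝ) (k + 1)), ← abs_mul, h, abs_mul,
        abs_of_nonneg (Nat.cast_nonneg (α := ℝ) (k + 1)), mul_one]
      push_cast
      calc _ ≤ 1 * ((k : ℝ) + 1) := mul_le_mul ih hk (abs_nonneg _) zero_le_one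
        _ = _ := one_mul _
    exact le_of_mul_le_mul_left h2 (by positivity)

section PowerSeries

variable {R : Type*} [NormedCommRing R] [NormedAlgebra ℝ R]

theorem antidiagonal_sum_smul_pow (x : R) (F G : PowerSeries ℝ) (n : ℕ) :
    ∑ kl ∈ Finset.HasAntidiagonal.antidiagonal n,
      (PowerSeries.coeff kl.1 F • x ^ kl.1) * (PowerSeries.coeff kl.2 G • x ^ kl.2) =
      PowerSeries.coeff n (F * G) • x ^ n := by
  rw [PowerSeries.coeff_mul, Finset.sum_smul]
  refine Finset.sum_congr rfl fun kl hkl => ?_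
  rw [smul_mul_smul_comm, ← pow_add, Finset.HasAntidiagonal.mem_antidiagonal.1 hkl]

theorem tsum_coeff_pow [CompleteSpace R] (x : R) (F : PowerSeries ℝ)
    (hF : Summable fun n => ‖PowerSeries.coeff n F • x ^ n‖) (m : ℕ) :
    (Summable fun n => ‖PowerSeries.coeff n (F ^ m) • x ^ n‖) ∧
      ∑' n, PowerSeries.coeff n (F ^ m) • x ^ n = (∑' n, PowerSeries.coeff n F • x ^ n) ^ m := by
  induction m with
  | zero =>
    have h : ∀ n ∉ ({0} : Finset ℕ), PowerSeries.coeff n (1 : PowerSeries ℝ) • x ^ n = 0 := by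
      intro n hn
      rw [PowerSeries.coeff_one, if_neg (by simpa using hn), zero_smul]
    refine ⟨summable_of_ne_finset_zero (s := {0}) fun n hn => ?_, ?_⟩
    · rw [pow_zero, h n hn, norm_zero]
    · rw [pow_zero, pow_zero, tsum_eq_sum h]; simp
  | succ m ih =>
    refine ⟨?_, ?_⟩
    · simpa only [antidiagonal_sum_smul_pow, ← pow_succ] using
        summable_norm_sum_mul_antidiagonal_of_summable_norm ih.1 hF
    · rw [pow_succ (∑' n, _) m, ← ih.2,
        tsum_mul_tsum_eq_tsum_sum_antidiagonal_of_summable_norm ih.1 hF]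
      simp only [antidiagonal_sum_smul_pow, ← pow_succ]

theorem binomialSeries_pow (r : ℝ) (m : ℕ) :
    PowerSeries.binomialSeries ℝ r ^ m = PowerSeries.binomialSeries ℝ (m * r) := by
  induction m with
  | zero => simp
  | succ m ih => rw [pow_succ, ih, ← PowerSeries.binomialSeries_add]; congr 1; push_cast; ring

theorem exists_pow_eq_one_add [CompleteSpace R] {x : R} (hx : ‖x‖ < 1) {m : ℕ} (hm : m ≠ 0) :
    ∃ p : R, p ^ m = 1 + x := by
  have hm' : (m : ℝ) ≠ 0 := Nat.cast_ne_zero.2 hm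
  set F := PowerSeries.binomialSeries ℝ ((m : ℝ)⁻¹) with hFdef
  -- The constant term is dropped because `‖1‖ ≤ 1` is not assumed.
  have hF : Summable fun n => ‖PowerSeries.coeff n F • x ^ n‖ := by
    rw [← summable_nat_add_iff 1]
    refine Summable.of_nonneg_of_le (fun _ => norm_nonneg _) (fun n => ?_)
      ((summable_nat_add_iff 1).2 (summable_geometric_of_lt_one (norm_nonneg x) hx))
    have h1 : |Ring.choose ((m : ℝ)⁻¹) (n + 1)| ≤ 1 :=
      abs_choose_le_one (by positivity) (Nat.cast_inv_le_one m) _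
    rw [norm_smul, hFdef, PowerSeries.binomialSeries_coeff, smul_eq_mul, mul_one, Real.norm_eq_abs]
    calc _ ≤ 1 * ‖x‖ ^ (n + 1) :=
          mul_le_mul h1 (norm_pow_le' x n.succ_pos) (norm_nonneg _) zero_le_one
      _ = _ := one_mul _
  refine ⟨∑' n, PowerSeries.coeff n F • x ^ n, ?_⟩
  have hpow : F ^ m = 1 + PowerSeries.X := by
    rw [hFdef, binomialSeries_pow, mul_inv_cancel₀ hm']
    simpa using PowerSeries.binomialSeries_nat (R := ℝ) (A := ℝ) 1
  rw [← (tsum_coeff_pow x F hF m).2, hpow, tsum_eq_sum (s := Finset.range 2)]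
  · simp [Finset.sum_range_succ, PowerSeries.coeff_one, PowerSeries.coeff_X]
  · intro n hn
    rw [Finset.mem_range, not_lt] at hn
    rw [map_add, PowerSeries.coeff_one, PowerSeries.coeff_X, if_neg (by omega), if_neg (by omega)]
    simp

end PowerSeries

/-- In a seminormed commutative algebra, `1 + x` is a limit of `m`-th powers when `‖x‖ < 1`. -/
theorem one_add_mem_closure_range_pow {R : Type*} [SeminormedCommRing R] [NormedAlgebra ℝ R]
    {x : R} (hx : ‖x‖ < 1) {m : ℕ} (hm : m ≠ 0) :
    1 + x ∈ closure (Set.range fun p : R => p ^ m) := by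
  obtain ⟨p, hp⟩ := exists_pow_eq_one_add (R := UniformSpace.Completion R) (x := (x : _))
    (by rwa [UniformSpace.Completion.norm_coe]) hm
  rw [UniformSpace.Completion.isDenseInducing_coe.isInducing.closure_eq_preimage_closure_image,
    Set.mem_preimage, UniformSpace.Completion.coe_add, UniformSpace.Completion.coe_one, ← hp]
  have hc : Continuous fun q : UniformSpace.Completion R => q ^ m := continuous_pow m
  have := map_mem_closure hc (UniformSpace.Completion.denseRange_coe p)
    (t := (fun a : R => (a : UniformSpace.Completion R)) '' Set.range fun p : R => p ^ m)
  refine this ?_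
  rintro _ ⟨q, rfl⟩
  exact ⟨q ^ m, ⟨q, rfl⟩, map_pow (UniformSpace.Completion.coeRingHom (α := R)) q m⟩

/-! ### Positive functionals, extreme states and characters -/

section Algebra

variable {A : Type*} [CommRing A] [Algebra ℝ A] {ρ : Seminorm ℝ A}

/-- The seminormed ring structure defined by a submultiplicative seminorm. -/
abbrev IsSubmultiplicative.toSeminormedCommRing (hρ : IsSubmultiplicative ρ) :
    SeminormedCommRing A :=
  { ‹CommRing A›, ρ.toSeminormedAddCommGroup with
    norm_mul_le := fun a b => (hρ a b : ρ (a * b) ≤ ρ a * ρ b) }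

theorem IsSubmultiplicative.exists_pow_sub_lt (hρ : IsSubmultiplicative ρ) {x : A} (hx : ρ x < 1)
    {m : ℕ} (hm : m ≠ 0) {ε : ℝ} (hε : 0 < ε) : ∃ p : A, ρ (1 + x - p ^ m) < ε := by
  let _ := hρ.toSeminormedCommRing
  let _ : NormedAlgebra ℝ A :=
    { ‹Algebra ℝ A› with norm_smul_le := fun r a => (map_smul_eq_mul ρ r a).le }
  obtain ⟨_, ⟨p, rfl⟩, hp⟩ := Metric.mem_closure_iff.1
    (one_add_mem_closure_range_pow (R := A) (x := x) hx hm) ε hε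
  exact ⟨p, by rwa [dist_eq_norm] at hp⟩

theorem isSeminormContinuous_iff (f : A →ₗ[ℝ] ℝ) :
    IsSeminormContinuous ρ f ↔ ∃ C, 0 ≤ C ∧ ∀ x, |f x| ≤ C * ρ x := by
  let _ := ρ.toSeminormedAddCommGroup
  let _ : NormedSpace ℝ A := { norm_smul_le := fun r a => (map_smul_eq_mul ρ r a).le }
  constructor
  · intro h
    let g : A →L[ℝ] ℝ := ⟨f, h⟩
    exact ⟨‖g‖, norm_nonneg _, fun x => g.le_opNorm x⟩
  · rintro ⟨C, -, hC⟩
    exact (f.mkContinuous C hC).continuous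

theorem IsSubmultiplicative.map_pow_le (hρ : IsSubmultiplicative ρ) (a : A) {n : ℕ} (hn : n ≠ 0) :
    ρ (a ^ n) ≤ ρ a ^ n := by
  induction n with
  | zero => exact absurd rfl hn
  | succ n ih =>
    rcases eq_or_ne n 0 with rfl | h
    · simp
    · rw [pow_succ, pow_succ]
      exact (hρ _ _).trans (mul_le_mul_of_nonneg_right (ih h) (apply_nonneg ρ a))

/-- A linear functional bounded by `C ρ` and nonnegative on `m`-th powers. -/
structure IsPositiveFunctional (ρ : Seminorm ℝ A) (m : ℕ) (f : A →ₗ[ℝ] ℝ) : Prop where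
  bounded : ∃ C, 0 ≤ C ∧ ∀ x, |f x| ≤ C * ρ x
  nonneg : ∀ a, 0 ≤ f (a ^ m)

/-- If `p ^ m` is close to `1 + x`, the value is close to `f ((p * b) ^ m)`. -/
theorem IsPositiveFunctional.nonneg_pow_mul {m : ℕ} (hm : m ≠ 0) (hρ : IsSubmultiplicative ρ)
    {f : A →ₗ[ℝ] ℝ} (hf : IsPositiveFunctional ρ m f) {x : A} (hx : ρ x < 1) (b : A) :
    0 ≤ f ((1 + x) * b ^ m) := by
  obtain ⟨C, hC, hb⟩ := hf.bounded
  refine le_of_forall_pos_sub_le fun ε hε => ?_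
  have hρb : 0 ≤ ρ (b ^ m) := apply_nonneg ρ _
  obtain ⟨p, hp⟩ := hρ.exists_pow_sub_lt hx hm (ε := ε / (C * ρ (b ^ m) + 1)) (by positivity)
  have h1 := hf.nonneg (p * b)
  have h2 : |f ((1 + x - p ^ m) * b ^ m)| ≤ ε := by
    calc _ ≤ C * ρ ((1 + x - p ^ m) * b ^ m) := hb _
      _ ≤ C * (ρ (1 + x - p ^ m) * ρ (b ^ m)) := by gcongr; exact hρ _ _
      _ = ρ (1 + x - p ^ m) * (C * ρ (b ^ m)) := by ring
      _ ≤ ε / (C * ρ (b ^ m) + 1) * (C * ρ (b ^ m) + 1) := by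
        gcongr; linarith
      _ = ε := by field_simp
  rw [sub_mul, map_sub, ← mul_pow] at h2
  linarith [(abs_le.1 h2).1]

theorem IsPositiveFunctional.abs_le {m : ℕ} (hm : m ≠ 0) (hρ : IsSubmultiplicative ρ)
    {f : A →ₗ[ℝ] ℝ} (hf : IsPositiveFunctional ρ m f) (y : A) : |f y| ≤ f 1 * ρ y := by
  have key : ∀ y, -f y ≤ f 1 * ρ y := by
    intro y
    have h1 : 0 ≤ f 1 := by simpa using hf.nonneg 1
    refine le_of_forall_pos_le_add fun ε hε => ?_
    have hy : 0 ≤ ρ y := apply_nonneg ρ y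
    -- Dividing by `ρ y + δ` makes the seminorm strictly less than 1, even when `ρ y = 0`.
    set δ := ε / (f 1 + 1) with hδ
    have hδ0 : 0 < δ := by positivity
    have ht : 0 < ρ y + δ := by positivity
    have hx : ρ ((ρ y + δ)⁻¹ • y) < 1 := by
      rw [map_smul_eq_mul, Real.norm_eq_abs, abs_of_pos (inv_pos.2 ht), inv_mul_lt_one₀ ht]
      linarith
    have := hf.nonneg_pow_mul hm hρ hx 1
    rw [one_pow, mul_one, map_add, map_smul, smul_eq_mul] at this
    have h3 : 0 ≤ (ρ y + δ) * (f 1 + (ρ y + δ)⁻¹ * f y) := by positivity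
    rw [mul_add, mul_inv_cancel_left₀ ht.ne'] at h3
    have h4 : f 1 * δ ≤ ε := by
      rw [hδ, mul_div_assoc', div_le_iff₀ (by positivity)]; nlinarith
    linarith
  rw [_root_.abs_le]
  refine ⟨by linarith [key y], ?_⟩
  have := key (-y)
  simpa using this

/-- The normalised functionals which are nonnegative on `m`-th powers and dominated by `ρ`. -/
def states (ρ : Seminorm ℝ A) (m : ℕ) : Set (A → ℝ) :=
  {f | ((∀ x y, f (x + y) = f x + f y) ∧ (∀ (r : ℝ) x, f (r • x) = r * f x)) ∧ f 1 = 1 ∧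
    (∀ x, |f x| ≤ ρ x) ∧ ∀ a, 0 ≤ f (a ^ m)}

theorem isCompact_states (ρ : Seminorm ℝ A) (m : ℕ) : IsCompact (states ρ m) := by
  refine (isCompact_univ_pi fun x : A => isCompact_Icc (a := -ρ x) (b := ρ x)).of_isClosed_subset
    ?_ fun f hf x _ => abs_le.1 (hf.2.2.1 x)
  simp only [states, Set.ofPred_and, Set.ofPred_forall]
  refine ((isClosed_iInter fun x => isClosed_iInter fun y => isClosed_eq ?_ ?_).inter
    (isClosed_iInter fun x => isClosed_iInter fun y => isClosed_eq ?_ ?_)).inter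
    ((isClosed_eq ?_ ?_).inter ((isClosed_iInter fun x => isClosed_le ?_ ?_).inter
      (isClosed_iInter fun x => isClosed_le ?_ ?_))) <;> fun_prop

theorem convex_states (ρ : Seminorm ℝ A) (m : ℕ) : Convex ℝ (states ρ m) := by
  rintro f ⟨⟨f1, f2⟩, f3, f4, f5⟩ g ⟨⟨g1, g2⟩, g3, g4, g5⟩ s t hs ht hst
  refine ⟨⟨fun x y => ?_, fun r x => ?_⟩, ?_, fun x => ?_, fun a => ?_⟩ <;>
    simp only [Pi.add_apply, Pi.smul_apply, smul_eq_mul]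
  · rw [f1, g1]; ring
  · rw [f2, g2]; ring
  · rw [f3, g3]; linarith
  · calc |s * f x + t * g x| ≤ |s * f x| + |t * g x| := abs_add_le _ _
      _ = s * |f x| + t * |g x| := by rw [abs_mul, abs_mul, abs_of_nonneg hs, abs_of_nonneg ht]
      _ ≤ s * ρ x + t * ρ x := by gcongr <;> simp [f4, g4]
      _ = ρ x := by rw [← add_mul, hst, one_mul]
  · have := f5 a; have := g5 a; positivity

theorem mem_states_of_linearMap {m : ℕ} (hm : m ≠ 0) (hρ : IsSubmultiplicative ρ)
    {f : A →ₗ[ℝ] ℝ} (hf : IsPositiveFunctional ρ m f) (h1 : 0 < f 1) :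
    (fun x => (f 1)⁻¹ * f x) ∈ states ρ m := by
  refine ⟨⟨fun x y => ?_, fun r x => ?_⟩, inv_mul_cancel₀ h1.ne', fun x => ?_, fun a => ?_⟩
  · simp only [map_add, mul_add]
  · simp only [map_smul, smul_eq_mul]; ring
  · rw [abs_mul, abs_of_pos (inv_pos.2 h1), inv_mul_le_iff₀ h1]
    exact hf.abs_le hm hρ x
  · have := hf.nonneg a; positivity

theorem map_mul_of_mem_extremePoints {m : ℕ} (hm : m ≠ 0) (hρ : IsSubmultiplicative ρ)
    {f : A → ℝ} (hf : f ∈ (states ρ m).extremePoints ℝ) (x y : A) : f (x * y) = f x * f y := by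
  have hfs := hf.1
  obtain ⟨⟨f1, f2⟩, f3, f4, f5⟩ := hfs
  let F : A →ₗ[ℝ] ℝ := ⟨⟨f, f1⟩, f2⟩
  have hF : IsPositiveFunctional ρ m F :=
    ⟨⟨1, zero_le_one, fun x => (f4 x).trans_eq (one_mul _).symm⟩, f5⟩
  have key : ∀ x y : A, ρ x < 1 → f (x * y) = f x * f y := by
    intro x y hx
    have hG : ∀ z, ρ z < 1 → (fun w => (f (1 + z))⁻¹ * f ((1 + z) * w)) ∈ states ρ m ∧
        0 < f (1 + z) := by
      intro z hz
      let G : A →ₗ[ℝ] ℝ := F ∘ₗ LinearMap.mulLeft ℝ (1 + z)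
      have hG : IsPositiveFunctional ρ m G :=
        ⟨⟨ρ (1 + z), apply_nonneg _ _, fun w => (f4 _).trans (hρ _ _)⟩,
          fun a => hF.nonneg_pow_mul hm hρ hz a⟩
      have hG1 : G 1 = f (1 + z) := congrArg f (mul_one _)
      have hpos : 0 < f (1 + z) := by
        rw [f1, f3]; linarith [(abs_le.1 (f4 z)).1]
      refine ⟨?_, hpos⟩
      have := mem_states_of_linearMap hm hρ hG (hG1 ▸ hpos)
      rwa [hG1] at this
    obtain ⟨hp, hp0⟩ := hG x hx
    obtain ⟨hn, hn0⟩ := hG (-x) (by rwa [map_neg_eq_map])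
    have hneg : ∀ w, f (-w) = -f w := fun w => F.map_neg w
    have hsum : f (1 + x) + f (1 + -x) = 2 := by rw [f1, f1, hneg, f3]; ring
    -- The twists by `1 ± x`, with weights `f (1 ± x) / 2`, average to `f`; extremality identifies
    -- the first twist with `f`.
    have := hf.2 hp hn ⟨f (1 + x) / 2, f (1 + -x) / 2, by positivity, by positivity,
      by linarith, ?_⟩
    · have h := congrFun this y
      rw [inv_mul_eq_iff_eq_mul₀ hp0.ne', add_mul, one_mul, f1, f1, f3] at h
      linarith
    · ext w
      simp only [Pi.add_apply, Pi.smul_apply, smul_eq_mul]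
      have e1 : f (1 + x) / 2 * ((f (1 + x))⁻¹ * f ((1 + x) * w)) = f ((1 + x) * w) / 2 := by
        field_simp
      have e2 : f (1 + -x) / 2 * ((f (1 + -x))⁻¹ * f ((1 + -x) * w)) = f ((1 + -x) * w) / 2 := by
        field_simp
      rw [e1, e2, add_mul, add_mul, one_mul, f1, f1, neg_mul, hneg]
      ring
  have hx : 0 ≤ ρ x := apply_nonneg ρ x
  have ht : 0 < ρ x + 1 := by positivity
  have := key ((ρ x + 1)⁻¹ • x) y (by
    rw [map_smul_eq_mul, Real.norm_eq_abs, abs_of_pos (inv_pos.2 ht), inv_mul_lt_one₀ ht]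
    linarith)
  rw [smul_mul_assoc, f2, f2, mul_assoc] at this
  exact mul_left_cancel₀ (inv_ne_zero ht.ne') this

/-- Multiplicativity gives `|α a| ^ n ≤ C * ρ a ^ n` for all `n ≥ 1`, which improves the constant
`C` to 1. -/
theorem mem_gelfandSpectrum_iff (hρ : IsSubmultiplicative ρ) (α : Characters A) :
    α ∈ gelfandSpectrum ρ ↔ ∀ a, |α a| ≤ ρ a := by
  have h := isSeminormContinuous_iff (ρ := ρ) α.toLinearMap
  refine ⟨fun hα a => ?_, fun hα => h.2 ⟨1, zero_le_one, by simpa using hα⟩⟩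
  obtain ⟨C, hC, hb⟩ := h.1 hα
  by_contra! hlt
  have ha : 0 ≤ ρ a := apply_nonneg ρ a
  have hpos : 0 < |α a| := ha.trans_lt hlt
  have hle : ∀ n : ℕ, |α a| ^ (n + 1) ≤ C * ρ a ^ (n + 1) := fun n =>
    calc |α a| ^ (n + 1) = |α (a ^ (n + 1))| := by rw [map_pow, abs_pow]
      _ ≤ C * ρ (a ^ (n + 1)) := hb _
      _ ≤ _ := by gcongr; exact hρ.map_pow_le a n.succ_ne_zero
  have ht : Tendsto (fun n : ℕ => C * (ρ a / |α a|) ^ (n + 1)) atTop (𝓝 (C * 0)) :=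
    ((tendsto_pow_atTop_nhds_zero_of_lt_one (by positivity)
      ((div_lt_one hpos).2 hlt)).comp (tendsto_add_atTop_nat 1)).const_mul C
  rw [mul_zero] at ht
  refine absurd (ge_of_tendsto' ht fun n => ?_) (not_le.2 (zero_lt_one (α := ℝ)))
  rw [div_pow, mul_div_assoc', le_div_iff₀ (by positivity), one_mul]
  exact hle n

/-- A functional nonnegative on `m`-th powers is nonnegative on the elements which are
nonnegative on the Gelfand spectrum. -/
theorem IsPositiveFunctional.nonneg_of_forall_gelfandSpectrum {m : ℕ} (hm : m ≠ 0)
    (hρ : IsSubmultiplicative ρ) {L : A →ₗ[ℝ] ℝ} (hL : IsPositiveFunctional ρ m L) {a : A}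
    (ha : ∀ α ∈ gelfandSpectrum ρ, 0 ≤ α a) : 0 ≤ L a := by
  have h1 : 0 ≤ L 1 := by simpa using hL.nonneg 1
  rcases h1.eq_or_lt with h0 | hpos
  · have := hL.abs_le hm hρ a
    rw [← h0, zero_mul, abs_nonpos_iff] at this
    exact this.ge
  · have hmem := mem_states_of_linearMap hm hρ hL hpos
    rw [← closure_convexHull_extremePoints (isCompact_states ρ m) (convex_states ρ m)] at hmem
    have hsub : closure (convexHull ℝ ((states ρ m).extremePoints ℝ)) ⊆ {f | 0 ≤ f a} := by
      refine closure_minimal (convexHull_min (fun f hf => ?_) ?_)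
        (isClosed_le continuous_const (continuous_apply a))
      · have hfs := hf.1
        obtain ⟨⟨f1, f2⟩, f3, f4, f5⟩ := hfs
        let α : Characters A := AlgHom.ofLinearMap (⟨⟨f, f1⟩, f2⟩ : A →ₗ[ℝ] ℝ) f3
          (map_mul_of_mem_extremePoints hm hρ hf)
        exact ha α ((mem_gelfandSpectrum_iff hρ α).2 f4)
      · intro f hf g hg s t hs ht _
        have h1 : 0 ≤ f a := hf
        have h2 : 0 ≤ g a := hg
        show 0 ≤ s * f a + t * g a
        positivity
    have h2 : 0 ≤ (L 1)⁻¹ * L a := hsub hmem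
    exact (mul_nonneg_iff_of_pos_left (inv_pos.2 hpos)).1 h2

end Algebra

/-! ### Compactness of the spectrum and existence of the measure -/

section Topological

variable {A : Type*} [CommRing A] [Algebra ℝ A] {ρ : Seminorm ℝ A}

theorem isInducing_coe_characters :
    IsInducing fun (α : Characters A) (a : A) => α a := ⟨rfl⟩

@[fun_prop]
theorem continuous_hat (a : A) : Continuous (hat a) :=
  (continuous_apply a).comp isInducing_coe_characters.continuous

instance instT2SpaceCharacters : T2Space (Characters A) :=
  T2Space.of_injective_continuous (f := fun (α : Characters A) (a : A) => α a)
    DFunLike.coe_injective isInducing_coe_characters.continuous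

theorem isClosed_nonnegSet (S : Set A) : IsClosed (nonnegSet S) := by
  simp only [nonnegSet, Set.ofPred_forall]
  exact isClosed_biInter fun a _ => isClosed_le continuous_const (continuous_hat a)

theorem isCompact_gelfandSpectrum (hρ : IsSubmultiplicative ρ) :
    IsCompact (gelfandSpectrum ρ) := by
  rw [isInducing_coe_characters.isCompact_iff]
  have himage : (fun (α : Characters A) (a : A) => α a) '' gelfandSpectrum ρ =
      {f | (∀ x y, f (x + y) = f x + f y) ∧ (∀ (r : ℝ) x, f (r • x) = r * f x) ∧ f 1 = 1 ∧
        (∀ x y, f (x * y) = f x * f y) ∧ ∀ x, |f x| ≤ ρ x} := by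
    ext f
    constructor
    · rintro ⟨α, hα, rfl⟩
      exact ⟨map_add α, map_smul α, map_one α, map_mul α, (mem_gelfandSpectrum_iff hρ α).1 hα⟩
    · rintro ⟨f1, f2, f3, f4, f5⟩
      exact ⟨AlgHom.ofLinearMap (⟨⟨f, f1⟩, f2⟩ : A →ₗ[ℝ] ℝ) f3 f4,
        (mem_gelfandSpectrum_iff hρ _).2 f5, rfl⟩
  rw [himage]
  refine (isCompact_univ_pi fun x : A => isCompact_Icc (a := -ρ x) (b := ρ x)).of_isClosed_subset
    ?_ fun f hf x _ => abs_le.1 (hf.2.2.2.2 x)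
  simp only [Set.ofPred_and, Set.ofPred_forall]
  refine (isClosed_iInter fun x => isClosed_iInter fun y => isClosed_eq ?_ ?_).inter
    ((isClosed_iInter fun x => isClosed_iInter fun y => isClosed_eq ?_ ?_).inter
    ((isClosed_eq ?_ ?_).inter ((isClosed_iInter fun x => isClosed_iInter fun y =>
      isClosed_eq ?_ ?_).inter
      (isClosed_iInter fun x => isClosed_le ?_ ?_)))) <;> fun_prop

/-- Evaluation of the elements of `A` on a set of characters. -/
def restrictHat (K : Set (Characters A)) : A →ₐ[ℝ] C(K, ℝ) where
  toFun a := ⟨fun α => hat a α, by fun_prop⟩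
  map_one' := by ext α; exact map_one α.1
  map_mul' a b := by ext α; exact map_mul α.1 a b
  map_zero' := by ext α; exact map_zero α.1
  map_add' a b := by ext α; exact map_add α.1 a b
  commutes' r := by ext α; exact α.1.commutes r

@[simp]
theorem restrictHat_apply (K : Set (Characters A)) (a : A) (α : K) :
    restrictHat K a α = hat a α := rfl

/-- Riesz extension is applied on `A × C(K, ℝ)`, with cone `â + h ≥ 0` and `L` given on `A × 0`, so
`L` need not first be factored through `restrictHat K`. The cone contains `±(a, -â)`, which forces
the extension to agree at `(a, 0)` and `(0, â)`. -/
theorem exists_linearMap_extension {K : Set (Characters A)} (hK : IsCompact K) {L : A →ₗ[ℝ] ℝ}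
    (hpos : ∀ a, (∀ α ∈ K, 0 ≤ α a) → 0 ≤ L a) :
    ∃ Φ : C(K, ℝ) →ₗ[ℝ] ℝ, (∀ h, 0 ≤ h → 0 ≤ Φ h) ∧ ∀ a, Φ (restrictHat K a) = L a := by
  have : CompactSpace K := isCompact_iff_compactSpace.1 hK
  let s : PointedCone ℝ (A × C(K, ℝ)) :=
    { carrier := {p | 0 ≤ restrictHat K p.1 + p.2}
      add_mem' := fun {p q} hp hq => by
        have h : restrictHat K (p + q).1 + (p + q).2 =
          (restrictHat K p.1 + p.2) + (restrictHat K q.1 + q.2) := by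
          rw [Prod.fst_add, Prod.snd_add, map_add]; abel
        rw [Set.mem_ofPred_eq, h]
        exact add_nonneg hp hq
      zero_mem' := by
        simp
      smul_mem' := fun c p hp => by
        have h : restrictHat K (c • p).1 + (c • p).2 = (c : ℝ) • (restrictHat K p.1 + p.2) := by
          rw [smul_add, ← map_smul]; rfl
        rw [Set.mem_ofPred_eq, h]
        exact smul_nonneg c.2 hp }
  have hs : ∀ p, p ∈ s ↔ 0 ≤ restrictHat K p.1 + p.2 := fun p => Iff.rfl
  let f : (A × C(K, ℝ)) →ₗ.[ℝ] ℝ :=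
    { domain := LinearMap.ker (LinearMap.snd ℝ A C(K, ℝ))
      toFun := L ∘ₗ LinearMap.fst ℝ A C(K, ℝ) ∘ₗ Submodule.subtype _ }
  have hf : ∀ x : f.domain, f x = L x.1.1 := fun x => rfl
  have hdom : ∀ a : A, (a, 0) ∈ f.domain := fun a => LinearMap.mem_ker.2 rfl
  obtain ⟨g, hg, hgs⟩ := riesz_extension s f (by
    rintro ⟨⟨a, h⟩, hx⟩ hxs
    obtain rfl : h = 0 := hx
    rw [hf]
    refine hpos a fun α hα => ?_
    rw [hs] at hxs
    have h := hxs ⟨α, hα⟩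
    rw [add_zero] at h
    exact h) (by
    rintro ⟨a, h⟩
    -- Added to `(a, h)`, this yields the function `‖h‖ + h ≥ 0`.
    refine ⟨⟨(algebraMap ℝ A ‖h‖ - a, 0), hdom _⟩, ?_⟩
    rw [hs]
    intro α
    have := neg_le_of_abs_le (h.norm_coe_le_norm α)
    simp only [Prod.mk_add_mk, sub_add_cancel, zero_add, AlgHom.commutes]
    simp
    linarith)
  have hg0 : ∀ a, g (a, 0) = L a := fun a => hg ⟨(a, 0), hdom a⟩
  have hle : ∀ a, g (0, restrictHat K a) ≤ L a := fun a => by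
    have h := hgs (a, -restrictHat K a) (by rw [hs]; simp)
    rw [show ((a, -restrictHat K a) : A × C(K, ℝ)) = (a, 0) - (0, restrictHat K a) by simp,
      map_sub, hg0] at h
    linarith
  refine ⟨g ∘ₗ LinearMap.inr ℝ A C(K, ℝ), fun h hh => hgs (0, h) (by rw [hs]; simpa using hh),
    fun a => le_antisymm (hle a) ?_⟩
  have h := hle (-a)
  rw [map_neg, show ((0, -restrictHat K a) : A × C(K, ℝ)) = -(0, restrictHat K a) by simp,
    map_neg, map_neg] at h
  exact neg_le_neg_iff.1 h

theorem exists_radon_representing {K : Set (Characters A)} (hK : IsCompact K) {L : A →ₗ[ℝ] ℝ}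
    (hpos : ∀ a, (∀ α ∈ K, 0 ≤ α a) → 0 ≤ L a) :
    ∃ μ : Measure (Characters A), IsRadon μ ∧ Represents μ L := by
  have : CompactSpace K := isCompact_iff_compactSpace.1 hK
  obtain ⟨Φ, hΦ, hΦL⟩ := exists_linearMap_extension hK hpos
  let Λ : CompactlySupportedContinuousMap K ℝ →ₚ[ℝ] ℝ :=
    PositiveLinearMap.mk₀
      { toFun := fun h => Φ h.toContinuousMap
        map_add' := fun h k => Φ.map_add h.toContinuousMap k.toContinuousMap
        map_smul' := fun r h => Φ.map_smul r h.toContinuousMap }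
      fun h hh => hΦ _ hh
  let ν := RealRMK.rieszMeasure Λ
  have hemb : MeasurableEmbedding (Subtype.val : K → Characters A) :=
    MeasurableEmbedding.subtype_coe hK.measurableSet
  have hint : ∀ a, Integrable (fun α : K => hat a α.1) ν := fun a =>
    ((continuous_hat a).comp continuous_subtype_val).integrable_of_hasCompactSupport
      (HasCompactSupport.of_compactSpace _)
  have hfin : IsFiniteMeasure (ν.map Subtype.val) := Measure.isFiniteMeasure_map _ _
  refine ⟨ν.map Subtype.val, ⟨inferInstance,
    Measure.InnerRegular.map_of_continuous continuous_subtype_val⟩, fun a => ⟨?_, ?_⟩⟩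
  · exact hemb.integrable_map_iff.2 (hint a)
  · rw [hemb.integral_map, ← hΦL]
    exact (RealRMK.integral_rieszMeasure Λ
      (CompactlySupportedContinuousMap.continuousMapEquiv (restrictHat K a))).symm

end Topological

/-! ### Support and uniqueness -/

theorem continuous_integral_continuousMap {X : Type*} [TopologicalSpace X] [CompactSpace X]
    [MeasurableSpace X] [BorelSpace X] (ν : Measure X) [IsFiniteMeasure ν] :
    Continuous fun h : C(X, ℝ) => ∫ x, h x ∂ν := by
  have hint : ∀ h : C(X, ℝ), Integrable h ν := fun h =>
    h.continuous.integrable_of_hasCompactSupport (HasCompactSupport.of_compactSpace _)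
  refine (LipschitzWith.of_dist_le_mul (K := (ν.real Set.univ).toNNReal)
    fun h k => ?_).continuous
  rw [dist_eq_norm, dist_eq_norm, ← integral_sub (hint h) (hint k),
    Real.coe_toNNReal _ measureReal_nonneg, mul_comm]
  exact norm_integral_le_of_norm_le_const (.of_forall fun x => (h - k).norm_coe_le_norm x)

section Support

variable {A : Type*} [CommRing A] [Algebra ℝ A] {ρ : Seminorm ℝ A}

theorem denseRange_restrictHat {K : Set (Characters A)} (hK : IsCompact K) :
    DenseRange (restrictHat K) := by
  have : CompactSpace K := isCompact_iff_compactSpace.1 hK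
  have h := ContinuousMap.subalgebra_topologicalClosure_eq_top_of_separatesPoints
    (restrictHat K).range (by
      intro α β hne
      obtain ⟨a, ha⟩ : ∃ a, α.1 a ≠ β.1 a := by
        by_contra! h
        exact hne (Subtype.ext (AlgHom.ext h))
      exact ⟨_, ⟨_, ⟨a, rfl⟩, rfl⟩, ha⟩)
  intro f
  have hf : f ∈ (restrictHat K).range.topologicalClosure := h ▸ Algebra.mem_top
  exact hf

variable {L : A →ₗ[ℝ] ℝ} {μ : Measure (Characters A)}

theorem Represents.isFiniteMeasure (hμ : Represents μ L) : IsFiniteMeasure μ := by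
  have h : hat (1 : A) = fun _ => (1 : ℝ) := funext fun α => map_one α
  have h1 := (hμ 1).1
  rw [h, integrable_const_iff] at h1
  exact h1.resolve_left one_ne_zero

theorem hat_pow (a : A) (n : ℕ) (α : Characters A) : hat (a ^ n) α = hat a α ^ n := map_pow α a n

/-- Markov's inequality for `hat a ^ (2 * (n + 1))` bounds the measure of `{t ≤ |hat a|}` by `C * (ρ
a / t) ^ (2 * (n + 1))`, which tends to 0 if `t > ρ a`. -/
theorem Represents.measure_lt_abs_hat_eq_zero (hμ : Represents μ L) (hρ : IsSubmultiplicative ρ)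
    {C : ℝ} (hC : 0 ≤ C) (hL : ∀ x, |L x| ≤ C * ρ x) (a : A) : μ {α | ρ a < |hat a α|} = 0 := by
  have := hμ.isFiniteMeasure
  have ha : 0 ≤ ρ a := apply_nonneg ρ a
  have key : ∀ t, ρ a < t → μ {α | t ≤ |hat a α|} = 0 := by
    intro t ht
    have ht0 : 0 < t := ha.trans_lt ht
    rw [← measureReal_eq_zero_iff]
    refine le_antisymm ?_ measureReal_nonneg
    have hle : ∀ n : ℕ, μ.real {α | t ≤ |hat a α|} ≤ C * ((ρ a / t) ^ 2) ^ (n + 1) := by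
      intro n
      have h2 := mul_meas_ge_le_integral_of_nonneg (μ := μ) (f := hat (a ^ (2 * (n + 1))))
        (.of_forall fun α => by rw [hat_pow, pow_mul]; positivity)
        (hμ _).1 (t ^ (2 * (n + 1)))
      rw [← (hμ _).2] at h2
      have h3 : {α : Characters A | t ≤ |hat a α|} =
          {α | t ^ (2 * (n + 1)) ≤ hat (a ^ (2 * (n + 1))) α} := by
        ext α
        rw [Set.mem_ofPred_eq, Set.mem_ofPred_eq, hat_pow, ← (even_two_mul (n + 1)).pow_abs (hat a α),
          pow_le_pow_iff_left₀ ht0.le (abs_nonneg _) (by omega)]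
      rw [h3, ← pow_mul, div_pow, mul_div_assoc', le_div_iff₀ (by positivity), mul_comm]
      calc _ ≤ L (a ^ (2 * (n + 1))) := h2
        _ ≤ C * ρ (a ^ (2 * (n + 1))) := (le_abs_self _).trans (hL _)
        _ ≤ _ := by gcongr; exact hρ.map_pow_le a (by omega)
    have hlim : Tendsto (fun n : ℕ => C * ((ρ a / t) ^ 2) ^ (n + 1)) atTop (𝓝 (C * 0)) :=
      ((tendsto_pow_atTop_nhds_zero_of_lt_one (by positivity)
        (pow_lt_one₀ (by positivity) ((div_lt_one ht0).2 ht) two_ne_zero)).comp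
        (tendsto_add_atTop_nat 1)).const_mul C
    rw [mul_zero] at hlim
    exact ge_of_tendsto' hlim hle
  refine measure_mono_null (t := ⋃ n : ℕ, {α | ρ a + 1 / ((n : ℝ) + 1) ≤ |hat a α|})
    (fun α hα => ?_) (measure_iUnion_null fun n => key _ (lt_add_of_pos_right _ (by positivity)))
  obtain ⟨n, hn⟩ := exists_nat_one_div_lt (sub_pos.2 (show ρ a < |hat a α| from hα))
  exact Set.mem_iUnion.2 ⟨n, by rw [Set.mem_ofPred_eq]; linarith⟩

theorem Represents.support_subset_gelfandSpectrum (hμ : Represents μ L)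
    (hρ : IsSubmultiplicative ρ) (hL : ∃ C, 0 ≤ C ∧ ∀ x, |L x| ≤ C * ρ x) :
    μ.support ⊆ gelfandSpectrum ρ := by
  obtain ⟨C, hC, hL⟩ := hL
  intro α hα
  rw [mem_gelfandSpectrum_iff hρ]
  intro a
  have hcl : IsClosed {α : Characters A | |hat a α| ≤ ρ a} :=
    isClosed_le (continuous_hat a).abs continuous_const
  refine Measure.support_subset_of_isClosed hcl ?_ hα
  rw [mem_ae_iff]
  refine measure_mono_null (fun β hβ => ?_) (hμ.measure_lt_abs_hat_eq_zero hρ hC hL a)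
  exact lt_of_not_ge (show ¬|hat a β| ≤ ρ a from hβ)

variable {K : Set (Characters A)}

theorem map_comap_subtype (hK : IsCompact K) (hμK : μ Kᶜ = 0) :
    (μ.comap (Subtype.val : K → Characters A)).map Subtype.val = μ := by
  rw [map_comap_subtype_coe hK.measurableSet, Measure.restrict_eq_self_of_ae_mem]
  exact hμK

theorem integral_comap_subtype (hK : IsCompact K) (hμK : μ Kᶜ = 0) (f : Characters A → ℝ) :
    ∫ α : K, f α.1 ∂(μ.comap Subtype.val) = ∫ α, f α ∂μ := by
  rw [integral_subtype_comap hK.measurableSet, Measure.restrict_eq_self_of_ae_mem]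
  exact hμK

theorem IsRadon.regular_comap [IsFiniteMeasure μ] (h : IsRadon μ) (hK : IsCompact K) :
    (μ.comap (Subtype.val : K → Characters A)).Regular := by
  have hemb : MeasurableEmbedding (Subtype.val : K → Characters A) :=
    MeasurableEmbedding.subtype_coe hK.measurableSet
  have hfin : IsFiniteMeasure (μ.comap (Subtype.val : K → Characters A)) := inferInstance
  have : (μ.comap (Subtype.val : K → Characters A)).InnerRegular :=
    ⟨h.innerRegular.innerRegular.comap hemb (fun _ hU => hemb.measurableSet_image' hU)
      fun _ hr hC => IsInducing.subtypeVal.isCompact_preimage' hC hr⟩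
  infer_instance

/-- The integrals agree on the dense image of `A` in `C(K, ℝ)`, hence everywhere, and regular
measures on `K` are determined by them. -/
theorem Represents.unique {ν : Measure (Characters A)} (hμ : Represents μ L)
    (hν : Represents ν L) (hμr : IsRadon μ) (hνr : IsRadon ν) (hK : IsCompact K)
    (hμK : μ Kᶜ = 0) (hνK : ν Kᶜ = 0) : μ = ν := by
  have := hμ.isFiniteMeasure
  have := hν.isFiniteMeasure
  have : CompactSpace K := isCompact_iff_compactSpace.1 hK
  have := hμr.regular_comap hK
  have := hνr.regular_comap hK
  have hC : ∀ h : C(K, ℝ), ∫ α, h α ∂(μ.comap Subtype.val) = ∫ α, h α ∂(ν.comap Subtype.val) := by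
    refine fun h => congrFun ((denseRange_restrictHat hK).equalizer
      (continuous_integral_continuousMap _) (continuous_integral_continuousMap _) ?_) h
    ext a
    exact (integral_comap_subtype hK hμK (hat a)).trans
      ((hμ a).2.symm.trans ((hν a).2.trans (integral_comap_subtype hK hνK (hat a)).symm))
  have hcomap : μ.comap (Subtype.val : K → Characters A) = ν.comap Subtype.val :=
    Measure.ext_of_integral_eq_on_compactlySupported fun h => hC h.toContinuousMap
  rw [← map_comap_subtype hK hμK, ← map_comap_subtype hK hνK, hcomap]

/-- By density, `∫ h ^ m * ŝ ≥ 0` for every `h ∈ C(K, ℝ)`. For `h` the negative part of `ŝ` the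
integrand is `-h ^ (m + 1)`, so `h` vanishes almost everywhere. -/
theorem Represents.support_subset_nonneg (hμ : Represents μ L) (hK : IsCompact K)
    (hμK : μ Kᶜ = 0) {m : ℕ} (hm : m ≠ 0) {s : A}
    (hs : ∀ a, 0 ≤ L (a ^ m * s)) : ∀ α ∈ μ.support, 0 ≤ hat s α := by
  have := hμ.isFiniteMeasure
  have : CompactSpace K := isCompact_iff_compactSpace.1 hK
  set ν : Measure K := μ.comap Subtype.val with hν
  have hpos : ∀ h : C(K, ℝ), 0 ≤ ∫ α, (h ^ m * restrictHat K s) α ∂ν := by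
    intro h
    refine (denseRange_restrictHat hK).induction_on
      (p := fun h : C(K, ℝ) => 0 ≤ ∫ α, (h ^ m * restrictHat K s) α ∂ν) h
      (isClosed_le continuous_const
        ((continuous_integral_continuousMap ν).comp (by fun_prop))) fun a => ?_
    refine (hs a).trans_eq ?_
    rw [(hμ _).2, ← integral_comap_subtype hK hμK (hat (a ^ m * s))]
    refine integral_congr_ae (.of_forall fun α => ?_)
    rw [← map_pow, ← map_mul, restrictHat_apply]
  let g : C(K, ℝ) := (-restrictHat K s) ⊔ 0
  have hg : ∀ α, (g ^ m * restrictHat K s) α = -(g α ^ (m + 1)) := by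
    intro α
    have hgα : g α = max (-restrictHat K s α) 0 := rfl
    rw [ContinuousMap.mul_apply, ContinuousMap.pow_apply, pow_succ, ← mul_neg]
    rcases le_total 0 (restrictHat K s α) with h | h
    · rw [hgα, max_eq_right (by linarith), zero_pow hm, zero_mul, zero_mul]
    · rw [hgα, max_eq_left (by linarith), neg_neg]
  have hg0 : ∀ α, 0 ≤ g α := fun α => le_max_right _ _
  have hint : Integrable (fun α => g α ^ (m + 1)) ν :=
    (g.continuous.pow _).integrable_of_hasCompactSupport (HasCompactSupport.of_compactSpace _)
  have hzero : ∫ α, g α ^ (m + 1) ∂ν = 0 := by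
    refine le_antisymm ?_ (integral_nonneg fun α => pow_nonneg (hg0 α) _)
    have h := hpos g
    simp only [hg, integral_neg] at h
    linarith
  have hae := (integral_eq_zero_iff_of_nonneg (fun α => pow_nonneg (hg0 α) _) hint).1 hzero
  have hnull : ∀ᵐ α ∂μ, 0 ≤ hat s α := by
    have hae' : ∀ᵐ α ∂ν, 0 ≤ hat s α.1 := by
      filter_upwards [hae] with α hα
      have h0 : g α = 0 := pow_eq_zero_iff (m + 1).succ_ne_zero |>.1 (by
        rw [pow_succ]; simp [show g α ^ (m + 1) = 0 from hα])
      have := le_max_left (-restrictHat K s α) 0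
      have h1 : max (-restrictHat K s α) 0 = 0 := h0
      rw [h1] at this
      exact neg_nonpos.1 this
    rw [← map_comap_subtype hK hμK]
    exact (MeasurableEmbedding.subtype_coe hK.measurableSet).ae_map_iff.2 hae'
  exact fun α hα => Measure.support_subset_of_isClosed
    (isClosed_le continuous_const (continuous_hat s)) hnull hα

end Support

end RealMoment

open RealMoment

theorem corollary3p7 {A : Type*} [CommRing A] [Algebra ℝ A]
    (ρ : Seminorm ℝ A) (hρ : RealMoment.IsSubmultiplicative ρ)
    (d : ℕ) (hd : 1 ≤ d) (S : Set A) (hS : RealMoment.IsPowerModule d S)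
    (L : A →ₗ[ℝ] ℝ) (hL : RealMoment.IsSeminormContinuous ρ L) (hLS : ∀ s ∈ S, 0 ≤ L s) :
    (∃! μ : MeasureTheory.Measure (RealMoment.Characters A),
        RealMoment.IsRadon μ ∧ RealMoment.Represents μ L) ∧
      (∀ μ : MeasureTheory.Measure (RealMoment.Characters A),
        RealMoment.IsRadon μ → RealMoment.Represents μ L →
          μ.support ⊆ RealMoment.nonnegSet S ∩ RealMoment.gelfandSpectrum ρ) ∧
      IsCompact (RealMoment.nonnegSet S ∩ RealMoment.gelfandSpectrum ρ) := by
  have hm : 2 * d ≠ 0 := by omega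
  have hbound := (isSeminormContinuous_iff L).1 hL
  have hpos : IsPositiveFunctional ρ (2 * d) L :=
    ⟨hbound, fun a => hLS _ (by simpa using hS.pow_mul_mem a 1 hS.one_mem)⟩
  have hK := isCompact_gelfandSpectrum hρ
  have hsub : ∀ μ, Represents μ L → μ.support ⊆ gelfandSpectrum ρ := fun μ hμ =>
    hμ.support_subset_gelfandSpectrum hρ hbound
  -- Inner regularity is what makes the complement of the support null.
  have hnull : ∀ μ, IsRadon μ → Represents μ L → μ (gelfandSpectrum ρ)ᶜ = 0 := fun μ hr hμ =>
    have := hr.innerRegular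
    measure_mono_null (Set.compl_subset_compl.2 (hsub μ hμ))
      Measure.measure_compl_support_of_innerRegular
  refine ⟨?_, fun μ hr hμ => Set.subset_inter (fun α hα s hs => ?_) (hsub μ hμ),
    hK.inter_left (isClosed_nonnegSet S)⟩
  · obtain ⟨μ, hr, hμ⟩ := exists_radon_representing hK
      fun a ha => hpos.nonneg_of_forall_gelfandSpectrum hm hρ ha
    exact ⟨μ, ⟨hr, hμ⟩, fun ν hν =>
      hν.2.unique hμ hν.1 hr hK (hnull ν hν.1 hν.2) (hnull μ hr hμ)⟩
  · exact hμ.support_subset_nonneg hK (hnull μ hr hμ) hm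
      (fun a => hLS _ (hS.pow_mul_mem a s hs)) α hα
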